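/- Let $F$ be a real Banach lattice and let $E=F\oplus iF$ be the complex Banach lattice obtained by complexifying $F$, with modulus $|x+iy|=\sup_{\theta\in[0,2\pi)}(x\cos\theta+y\sin\theta)\in F$, norm $\|z\|=\|\,|z|\,\|_F$ and positive cone $E_+=F_+$. A net $(x_\alpha)$ in $E$ is $uo$-convergent to $x\in E$, written $x_\alpha\xrightarrow{uo}x$, if for every $u\in E_+$ the net $|x_\alpha-x|\wedge u$ converges in order to $0$; here a net $(v_\alpha)$ in $F$ converges in order to $0$ if there is a net $y_\beta\downarrow 0$ in $F$ (possibly with another index set) such that for every $\beta$ there is $\alpha_0$ with $|v_\alpha|\le y_\beta$ for all $\alpha\ge\alpha_0$. Assume that the norm of $E$ is order continuous, i.e. $\|y_\beta\|\to0$ for every net $y_\beta\downarrow0$. Then the following conditions are equivalent: 1. $E$ is a Brezis–Lieb space (BL-space): for every net $(x_\alpha)$ in $E$ and every $x\in E$, if $x_\alpha\xrightarrow{uo}x$ and $\|x_\alpha\|\to\|x\|$, then $\|x_\alpha-x\|\to0$. 2. $E$ is a $\sigma$-Brezis–Lieb space ($\sigma$-BL-space): for every sequence $(x_n)$ in $E$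 and every $x\in E$, if $x_n\xrightarrow{uo}x$ and $\|x_n\|\to\|x\|$, then $\|x_n-x\|\to0$. 3. $E$ has the Brezis–Lieb property (BL-property): $\limsup_{n\to\infty}\|u_0+u_n\|>\|u_0\|$ for every $u_0\in E_+$ and every sequence $(u_n)_{n\ge1}$ in $E_+$ with $\|u_n\|=1$ for all $n$ and $u_m\wedge u_n=0$ for all $m\ne n$. -/

import Mathlib

open Filter Topology

universe u v

/-- The complexification `E = F ⊕ iF` of `F`: the element `⟨x, y⟩` is `x + iy`. -/
@[ext]
structure Complexification (F : Type u) : Type u where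
  re : F
  im : F

namespace Complexification

instance {F : Type u} [AddCommGroup F] : Zero (Complexification F) := ⟨⟨0, 0⟩⟩

instance {F : Type u} [AddCommGroup F] : Add (Complexification F) :=
  ⟨fun z w => ⟨z.re + w.re, z.im + w.im⟩⟩

instance {F : Type u} [AddCommGroup F] : Neg (Complexification F) :=
  ⟨fun z => ⟨-z.re, -z.im⟩⟩

instance {F : Type u} [AddCommGroup F] : Sub (Complexification F) :=
  ⟨fun z w => ⟨z.re - w.re, z.im - w.im⟩⟩

instance {F : Type u} [AddCommGroup F] [Module ℝ F] : SMul ℂ (Complexification F) :=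
  ⟨fun c z => ⟨c.re • z.re - c.im • z.im, c.re • z.im + c.im • z.re⟩⟩

/-- The embedding of `F` into its complexification, `x ↦ x + i0`. -/
def ofReal {F : Type u} [AddCommGroup F] (x : F) : Complexification F := ⟨x, 0⟩

section Algebra

variable {F : Type u} [AddCommGroup F]

@[simp] theorem zero_re : (0 : Complexification F).re = 0 := rfl
@[simp] theorem zero_im : (0 : Complexification F).im = 0 := rfl
@[simp] theorem add_re (z w : Complexification F) : (z + w).re = z.re + w.re := rfl
@[simp] theorem add_im (z w : Complexification F) : (z + w).im = z.im + w.im := rfl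
@[simp] theorem neg_re (z : Complexification F) : (-z).re = -z.re := rfl
@[simp] theorem neg_im (z : Complexification F) : (-z).im = -z.im := rfl
@[simp] theorem sub_re (z w : Complexification F) : (z - w).re = z.re - w.re := rfl
@[simp] theorem sub_im (z w : Complexification F) : (z - w).im = z.im - w.im := rfl
@[simp] theorem smul_re [Module ℝ F] (c : ℂ) (z : Complexification F) :
    (c • z).re = c.re • z.re - c.im • z.im := rfl
@[simp] theorem smul_im [Module ℝ F] (c : ℂ) (z : Complexification F) :
    (c • z).im = c.re • z.im + c.im • z.re := rfl
@[simp] theorem ofReal_re (x : F) : (ofReal x).re = x := rfl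
@[simp] theorem ofReal_im (x : F) : (ofReal x).im = 0 := rfl

instance : AddCommGroup (Complexification F) where
  add_assoc a b c := by ext <;> simp [add_assoc]
  zero_add a := by ext <;> simp
  add_zero a := by ext <;> simp
  add_comm a b := by ext <;> simp [add_comm]
  neg_add_cancel a := by ext <;> simp
  sub_eq_add_neg a b := by ext <;> simp [sub_eq_add_neg]
  nsmul := nsmulRec
  zsmul := zsmulRec

instance [Module ℝ F] : Module ℂ (Complexification F) where
  one_smul a := by ext <;> simp
  mul_smul a b z := by
    ext <;> simp only [smul_re, smul_im, Complex.mul_re, Complex.mul_im] <;> module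
  smul_zero a := by ext <;> simp
  smul_add a z w := by ext <;> simp only [smul_re, smul_im, add_re, add_im] <;> module
  add_smul a b z := by
    ext <;> simp only [smul_re, smul_im, add_re, add_im, Complex.add_re, Complex.add_im] <;> module
  zero_smul a := by ext <;> simp

end Algebra

section Modulus

variable {F : Type u} [NormedAddCommGroup F] [Lattice F] [HasSolidNorm F] [IsOrderedAddMonoid F]
  [NormedSpace ℝ F] [IsOrderedModule ℝ F]

set_option linter.unusedSectionVars false

/-- The set `{x cos θ + y sin θ : θ ∈ [0, 2π)}` whose supremum is the modulus of `z = x + iy`. -/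
def rotations (z : Complexification F) : Set F :=
  (fun θ : ℝ => Real.cos θ • z.re + Real.sin θ • z.im) '' Set.Ico 0 (2 * Real.pi)

theorem smul_le_abs {c : ℝ} (t : ℝ) (x : F) (hc : |t| ≤ c) : t • x ≤ c • |x| := by
  have h1 : t • x ≤ |t| • |x| := by
    rcases le_total 0 t with ht | ht
    · rw [abs_of_nonneg ht]
      exact smul_le_smul_of_nonneg_left (le_abs_self x) ht
    · rw [abs_of_nonpos ht, ← neg_smul_neg]
      exact smul_le_smul_of_nonneg_left (neg_le_abs x) (neg_nonneg.2 ht)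
  exact h1.trans (smul_le_smul_of_nonneg_right hc (abs_nonneg x))

theorem rotation_le (z : Complexification F) (θ φ c : ℝ) (h : |θ - φ| ≤ c) :
    Real.cos θ • z.re + Real.sin θ • z.im ≤
      (Real.cos φ • z.re + Real.sin φ • z.im) + c • (|z.re| + |z.im|) := by
  have h1 := smul_le_abs (Real.cos θ - Real.cos φ) z.re
    ((Real.abs_cos_sub_cos_le θ φ).trans h)
  have h2 := smul_le_abs (Real.sin θ - Real.sin φ) z.im
    ((Real.abs_sin_sub_sin_le θ φ).trans h)
  have h3 := add_le_add h1 h2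
  rw [← sub_le_iff_le_add']
  convert h3 using 1 <;> module

theorem exists_isLUB_rotations [CompleteSpace F] (z : Complexification F) :
    ∃ s, IsLUB (rotations z) s := by
  set f : ℝ → F := fun θ => Real.cos θ • z.re + Real.sin θ • z.im with hf
  set e : F := |z.re| + |z.im| with he
  have hpi := Real.pi_pos
  let t : ℕ → ℕ → ℝ := fun n k => k * (2 * Real.pi / (n + 1))
  let c : ℕ → ℝ := fun n => 2 * Real.pi / (n + 1)
  have hc0 : ∀ n, 0 < c n := fun n => by positivity
  have htmem : ∀ n, ∀ k ∈ Finset.range (n + 1), t n k ∈ Set.Ico 0 (2 * Real.pi) := by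
    intro n k hk
    have hk' : (k : ℝ) < n + 1 := by exact_mod_cast Finset.mem_range.1 hk
    refine ⟨by positivity, ?_⟩
    calc t n k < (n + 1) * (2 * Real.pi / (n + 1)) := by
          exact mul_lt_mul_of_pos_right hk' (hc0 n)
      _ = 2 * Real.pi := by field_simp
  let s : ℕ → F := fun n =>
    (Finset.range (n + 1)).sup' ⟨0, by simp⟩ (fun k => f (t n k))
  have happrox : ∀ n, ∀ θ ∈ Set.Ico 0 (2 * Real.pi), f θ ≤ s n + c n • e := by
    intro n θ hθ
    set k := ⌊θ / c n⌋₊ with hk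
    have hq : 0 ≤ θ / c n := div_nonneg hθ.1 (hc0 n).le
    have h1 : (k : ℝ) * c n ≤ θ := by
      rw [← le_div_iff₀ (hc0 n)]; exact Nat.floor_le hq
    have h2 : θ < (k + 1) * c n := by
      rw [← div_lt_iff₀ (hc0 n)]; exact Nat.lt_floor_add_one _
    have hkn : k ∈ Finset.range (n + 1) := by
      rw [Finset.mem_range, hk, Nat.floor_lt hq, div_lt_iff₀ (hc0 n)]
      calc θ < 2 * Real.pi := hθ.2
        _ = ((n + 1 : ℕ) : ℝ) * c n := by simp only [c]; push_cast; field_simp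
    have h3 : |θ - t n k| ≤ c n := by
      have : t n k = k * c n := rfl
      rw [this, abs_le]; constructor <;> nlinarith [hc0 n]
    refine (rotation_le z θ (t n k) (c n) h3).trans ?_
    exact add_le_add_left (Finset.le_sup' (fun k => f (t n k)) hkn) _
  have hss : ∀ m n, s m ≤ s n + c n • e := fun m n =>
    Finset.sup'_le _ _ fun k hk => happrox n _ (htmem m k hk)
  have hc : Tendsto c atTop (𝓝 0) := by
    have := (tendsto_one_div_add_atTop_nhds_zero_nat (𝕜 := ℝ)).const_mul (2 * Real.pi)
    simpa [c, div_eq_mul_inv] using this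
  have hcanti : ∀ {m n : ℕ}, m ≤ n → c n ≤ c m := fun {m n} h => by
    have : (m : ℝ) ≤ n := by exact_mod_cast h
    simp only [c]; gcongr
  have he0 : 0 ≤ e := add_nonneg (abs_nonneg _) (abs_nonneg _)
  have hcauchy : CauchySeq s := by
    refine cauchySeq_of_le_tendsto_0' (fun n => c n * ‖e‖) (fun n m hnm => ?_) ?_
    · rw [dist_eq_norm, ← abs_of_pos (hc0 n), ← Real.norm_eq_abs, ← norm_smul]
      refine norm_le_norm_of_abs_le_abs ?_
      rw [abs_of_nonneg (smul_nonneg (hc0 n).le he0), abs_le']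
      constructor
      · rw [sub_le_iff_le_add']
        exact (hss n m).trans
          (add_le_add_right (smul_le_smul_of_nonneg_right (hcanti hnm) he0) _)
      · rw [neg_sub, sub_le_iff_le_add']
        exact hss m n
    · simpa using hc.mul_const ‖e‖
  obtain ⟨a, ha⟩ := cauchySeq_tendsto_of_complete hcauchy
  refine ⟨a, ?_, ?_⟩
  · rintro _ ⟨θ, hθ, rfl⟩
    have hlim : Tendsto (fun n => s n + c n • e) atTop (𝓝 (a + (0 : ℝ) • e)) :=
      ha.add (hc.smul_const e)
    rw [zero_smul, add_zero] at hlim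
    exact ge_of_tendsto' hlim fun n => happrox n θ hθ
  · intro b hb
    exact le_of_tendsto' ha fun n =>
      Finset.sup'_le _ _ fun k hk => hb ⟨t n k, htmem n k hk, rfl⟩

variable [CompleteSpace F]

/-- The modulus `|z| = sup {x cos θ + y sin θ : θ ∈ [0, 2π)}` of `z = x + iy`. -/
noncomputable def modulus (z : Complexification F) : F := (exists_isLUB_rotations z).choose

theorem isLUB_modulus (z : Complexification F) : IsLUB (rotations z) (modulus z) :=
  (exists_isLUB_rotations z).choose_spec

theorem le_modulus (z : Complexification F) (θ : ℝ) :
    Real.cos θ • z.re + Real.sin θ • z.im ≤ modulus z := by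
  have hp : Function.Periodic (fun θ : ℝ => Real.cos θ • z.re + Real.sin θ • z.im)
      (2 * Real.pi) := fun θ => by simp
  obtain ⟨φ, hφ, h⟩ := hp.exists_mem_Ico₀ Real.two_pi_pos θ
  exact h.le.trans ((isLUB_modulus z).1 ⟨φ, hφ, rfl⟩)

theorem modulus_le {z : Complexification F} {b : F}
    (h : ∀ θ : ℝ, Real.cos θ • z.re + Real.sin θ • z.im ≤ b) : modulus z ≤ b := by
  refine (isLUB_modulus z).2 ?_
  rintro _ ⟨θ, _, rfl⟩
  exact h θ

theorem abs_re_le_modulus (z : Complexification F) : |z.re| ≤ modulus z := by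
  rw [abs_le']
  exact ⟨by simpa using le_modulus z 0, by simpa using le_modulus z Real.pi⟩

theorem abs_im_le_modulus (z : Complexification F) : |z.im| ≤ modulus z := by
  rw [abs_le']
  exact ⟨by simpa using le_modulus z (Real.pi / 2), by simpa using le_modulus z (-(Real.pi / 2))⟩

theorem modulus_nonneg (z : Complexification F) : 0 ≤ modulus z :=
  (abs_nonneg _).trans (abs_re_le_modulus z)

theorem modulus_ofReal (x : F) : modulus (ofReal x) = |x| := by
  refine le_antisymm (modulus_le fun θ => ?_) (abs_re_le_modulus (ofReal x))
  simpa using smul_le_abs (Real.cos θ) x (Real.abs_cos_le_one θ)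

theorem modulus_add_le (z w : Complexification F) : modulus (z + w) ≤ modulus z + modulus w := by
  refine modulus_le fun θ => ?_
  convert add_le_add (le_modulus z θ) (le_modulus w θ) using 1
  simp only [add_re, add_im]
  module

theorem modulus_smul_le (c : ℂ) (z : Complexification F) : modulus (c • z) ≤ ‖c‖ • modulus z := by
  refine modulus_le fun θ => ?_
  have h := smul_le_smul_of_nonneg_left (le_modulus z (θ - c.arg)) (norm_nonneg c)
  convert h using 1
  simp only [smul_re, smul_im]
  conv_lhs => rw [← Complex.norm_mul_cos_arg c, ← Complex.norm_mul_sin_arg c]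
  rw [Real.cos_sub, Real.sin_sub]
  module

theorem modulus_smul (c : ℂ) (z : Complexification F) : modulus (c • z) = ‖c‖ • modulus z := by
  refine le_antisymm (modulus_smul_le c z) ?_
  rcases eq_or_ne c 0 with rfl | hc
  · simpa using modulus_nonneg _
  · have h := modulus_smul_le c⁻¹ (c • z)
    rw [inv_smul_smul₀ hc] at h
    have h2 := smul_le_smul_of_nonneg_left h (norm_nonneg c)
    rwa [norm_inv, smul_inv_smul₀ (norm_ne_zero_iff.2 hc)] at h2

/-- The norm `‖z‖ = ‖ |z| ‖` of the complexification. -/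
noncomputable instance : Norm (Complexification F) := ⟨fun z => ‖modulus z‖⟩

theorem norm_def (z : Complexification F) : ‖z‖ = ‖modulus z‖ := rfl

theorem norm_ofReal (x : F) : ‖ofReal x‖ = ‖x‖ := by
  rw [norm_def, modulus_ofReal, norm_abs_eq_norm]

theorem normedSpaceCore : NormedSpace.Core ℂ (Complexification F) where
  norm_nonneg z := norm_nonneg (modulus z)
  norm_smul c z := by rw [norm_def, modulus_smul, norm_smul, norm_norm, ← norm_def]
  norm_triangle z w := by
    refine (norm_le_norm_of_abs_le_abs ?_).trans (norm_add_le (modulus z) (modulus w))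
    rw [abs_of_nonneg (modulus_nonneg _),
      abs_of_nonneg (add_nonneg (modulus_nonneg _) (modulus_nonneg _))]
    exact modulus_add_le z w
  norm_eq_zero_iff z := by
    constructor
    · intro h
      have h0 : modulus z = 0 := norm_eq_zero.1 h
      ext
      · have h1 : |z.re| = 0 := le_antisymm (h0 ▸ abs_re_le_modulus z) (abs_nonneg _)
        rw [zero_re, ← norm_eq_zero, ← norm_abs_eq_norm, h1, norm_zero]
      · have h1 : |z.im| = 0 := le_antisymm (h0 ▸ abs_im_le_modulus z) (abs_nonneg _)
        rw [zero_im, ← norm_eq_zero, ← norm_abs_eq_norm, h1, norm_zero]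
    · rintro rfl
      exact (norm_ofReal (0 : F)).trans norm_zero

noncomputable instance : NormedAddCommGroup (Complexification F) :=
  NormedAddCommGroup.ofCore normedSpaceCore

noncomputable instance : NormedSpace ℂ (Complexification F) :=
  NormedSpace.ofCore normedSpaceCore

end Modulus

end Complexification

/-- `y_β ↓ 0`: the set `D` of the members of a decreasing net with infimum `0`, that is, a nonempty
downward directed set with infimum `0` (such a set is a decreasing net indexed by itself). -/
def DecreasesToZero {F : Type u} [Lattice F] [Zero F] (D : Set F) : Prop :=
  D.Nonempty ∧ DirectedOn (· ≥ ·) D ∧ IsGLB D 0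

/-- The norm of `F` (equivalently, of its complexification) is order continuous:
`x_α ↓ 0` implies `‖x_α‖ → 0`. Along a decreasing net of positive elements the norms decrease, so
this says that they become arbitrarily small. -/
def IsOrderContinuousNorm (F : Type u) [NormedAddCommGroup F] [Lattice F] : Prop :=
  ∀ D : Set F, DecreasesToZero D → ∀ ε : ℝ, 0 < ε → ∃ d ∈ D, ‖d‖ < ε

/-- The net `x` converges in order to `l` in the vector lattice `F`: there is `y_β ↓ 0` such that
for every `β` one has `|x_α - l| ≤ y_β` for all sufficiently large `α`. -/
def OrderTendsto {F : Type u} [Lattice F] [AddCommGroup F] {A : Type v} [Preorder A]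
    (x : A → F) (l : F) : Prop :=
  ∃ D : Set F, DecreasesToZero D ∧ ∀ d ∈ D, ∃ α₀ : A, ∀ α, α₀ ≤ α → |x α - l| ≤ d

section BrezisLieb

variable (F : Type u) [NormedAddCommGroup F] [Lattice F] [HasSolidNorm F] [IsOrderedAddMonoid F]
  [NormedSpace ℝ F] [IsOrderedModule ℝ F] [CompleteSpace F]

variable {F} in
/-- Unbounded order convergence of a net `z` to `w` in the complexification of `F`:
`|z_α - w| ∧ u` converges in order to `0` for every `u ≥ 0`. -/
def UOTendsto {A : Type v} [Preorder A] (z : A → Complexification F) (w : Complexification F) :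
    Prop :=
  ∀ u : F, 0 ≤ u → OrderTendsto (fun α => (z α - w).modulus ⊓ u) 0

/-- The complexification of `F` is a Brezis–Lieb space. The index sets of the nets range over all
nonempty directed preordered sets in an arbitrary universe `v`. -/
def IsBLSpace : Prop :=
  ∀ (A : Type v) [Preorder A] [IsDirectedOrder A] [Nonempty A]
    (z : A → Complexification F) (w : Complexification F),
    Tendsto (fun α => ‖z α‖) atTop (𝓝 ‖w‖) → UOTendsto z w →
      Tendsto (fun α => ‖z α - w‖) atTop (𝓝 0)

/-- The complexification of `F` is a σ-Brezis–Lieb space. -/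
def IsSigmaBLSpace : Prop :=
  ∀ (z : ℕ → Complexification F) (w : Complexification F),
    Tendsto (fun n => ‖z n‖) atTop (𝓝 ‖w‖) → UOTendsto z w →
      Tendsto (fun n => ‖z n - w‖) atTop (𝓝 0)

/-- The complexification `E` of `F` has the Brezis–Lieb property. The positive elements of `E` are
those of `F`, and the norm of `E` extends the norm of `F` (`Complexification.norm_ofReal`). -/
def HasBLProperty : Prop :=
  ∀ (u : ℕ → F) (u₀ : F), (∀ n, 0 ≤ u n) → (∀ n, ‖u n‖ = 1) →
    (∀ m n, m ≠ n → u m ⊓ u n = 0) → 0 ≤ u₀ →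
      ‖u₀‖ < limsup (fun n => ‖u₀ + u n‖) atTop

end BrezisLieb

/-! A net is a generalised sequence, so 1 gives 2. For 2 ⇒ 3, bounded disjoint sequences converge in
order to `0` (`orderTendsto_zero_of_disjoint`), so `u₀ + u n` is uo-convergent to `u₀`. If the
limsup did not exceed `‖u₀‖`, the norms would converge too and force `‖u n‖ → 0`.

For 3 ⇒ 1, let `z` be a counterexample with limit `w`. Order continuity turns uo-convergence into
`‖|z α - w| ⊓ s‖ → 0`, so `|w|` and `|z α - w|` are almost disjoint and `modulus_add_modulus_le`
bounds `‖|w| + |z α - w|‖` asymptotically by `‖w‖`. A Kadec–Pełczyński type disjointification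
(`exists_disjoint_seq`) places disjoint elements, with norms bounded away from `0`, below some of
the `|z α - w|`. Normalised, they violate the BL-property at a multiple of `|w|`. -/

namespace BrezisLieb

open Complexification

/-! ### Disjoint elements and order convergence. -/

theorem add_le_of_inf_eq_zero {G : Type*} [AddCommGroup G] [Lattice G] [IsOrderedAddMonoid G]
    {a b d : G} (h : a ⊓ b = 0) (ha : a ≤ d) (hb : b ≤ d) : a + b ≤ d := by
  rw [← inf_add_sup a b, h, zero_add]
  exact sup_le ha hb

theorem inf_eq_zero_of_le {G : Type*} [Lattice G] [Zero G] {a b c d : G}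
    (ha : 0 ≤ a) (hb : 0 ≤ b) (hac : a ≤ c) (hbd : b ≤ d) (h : c ⊓ d = 0) : a ⊓ b = 0 :=
  le_antisymm (h ▸ inf_le_inf hac hbd) (le_inf ha hb)

variable {F : Type u} [NormedAddCommGroup F] [Lattice F] [HasSolidNorm F] [IsOrderedAddMonoid F]

theorem norm_le_norm_of_nonneg_of_le {a b : F} (ha : 0 ≤ a) (hab : a ≤ b) : ‖a‖ ≤ ‖b‖ :=
  norm_le_norm_of_abs_le_abs (by rwa [abs_of_nonneg ha, abs_of_nonneg (ha.trans hab)])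

theorem eq_zero_of_nsmul_le [NormedSpace ℝ F] {w u : F} (hw : 0 ≤ w)
    (h : ∀ m : ℕ, m • w ≤ u) : w = 0 := by
  by_contra hne
  have hpos : 0 < ‖w‖ := norm_pos_iff.2 hne
  obtain ⟨m, hm⟩ := exists_nat_gt (‖u‖ / ‖w‖)
  have h1 := norm_le_norm_of_nonneg_of_le (nsmul_nonneg hw m) (h m)
  rw [RCLike.norm_nsmul ℝ, nsmul_eq_mul] at h1
  rw [div_lt_iff₀ hpos] at hm
  linarith

/-- A bounded disjoint sequence of positive elements converges in order to `0`. -/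
theorem orderTendsto_zero_of_disjoint [NormedSpace ℝ F] {a : ℕ → F} {u : F}
    (ha : ∀ n, 0 ≤ a n) (hau : ∀ n, a n ≤ u) (hdisj : ∀ m n, m ≠ n → a m ⊓ a n = 0) :
    OrderTendsto a 0 := by
  -- The eventual upper bounds of `a`. That their infimum is `0` is proved without any supremum of
  -- tails, which need not exist.
  let D : Set F := {d | ∃ n, ∀ k, n ≤ k → a k ≤ d}
  have huD : u ∈ D := ⟨0, fun k _ => hau k⟩
  refine ⟨D, ⟨⟨u, huD⟩, ?_, ?_, ?_⟩, ?_⟩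
  · rintro d ⟨n, hn⟩ e ⟨m, hm⟩
    exact ⟨d ⊓ e, ⟨max n m, fun k hk => le_inf (hn k ((le_max_left _ _).trans hk))
      (hm k ((le_max_right _ _).trans hk))⟩, inf_le_left, inf_le_right⟩
  · rintro d ⟨n, hn⟩
    exact (ha n).trans (hn n le_rfl)
  · intro v₀ hv₀
    -- If `w` is disjoint from a tail of `a`, then `a k + w ≤ d` eventually, so `D` is stable under
    -- subtracting `w`. Iterating gives `m • w ≤ u` for all `m`, and the Archimedean property yields
    -- `w = 0`.
    have key : ∀ w : F, 0 ≤ w → (∀ d ∈ D, w ≤ d) → (∃ N, ∀ k, N ≤ k → a k ⊓ w = 0) →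
        w = 0 := by
      intro w hw hwD ⟨N, hN⟩
      have step : ∀ m : ℕ, ∀ d ∈ D, m • w ≤ d := by
        intro m
        induction m with
        | zero =>
          rintro d ⟨n, hn⟩
          simpa using (ha n).trans (hn n le_rfl)
        | succ m ih =>
          intro d hd
          have hd' : d - w ∈ D := by
            obtain ⟨n, hn⟩ := hd
            refine ⟨max n N, fun k hk => ?_⟩
            rw [le_sub_iff_add_le]
            exact add_le_of_inf_eq_zero (hN k ((le_max_right _ _).trans hk))
              (hn k ((le_max_left _ _).trans hk)) (hwD d ⟨n, hn⟩)
          rw [succ_nsmul, ← le_sub_iff_add_le]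
          exact ih _ hd'
      exact eq_zero_of_nsmul_le hw fun m => step m u huD
    set v := v₀ ⊔ 0 with hv
    have hv0 : 0 ≤ v := le_sup_right
    have hvD : ∀ d ∈ D, v ≤ d := fun d hd =>
      sup_le (hv₀ hd) (by obtain ⟨n, hn⟩ := hd; exact (ha n).trans (hn n le_rfl))
    -- `a j ⊓ v` is disjoint from all `a k` with `k > j`, so `key` kills it; then `v` is disjoint
    -- from every `a j` and `key` applies to `v` itself.
    have hva : ∀ j, a j ⊓ v = 0 := by
      intro j
      refine key _ (le_inf (ha j) hv0) (fun d hd => inf_le_right.trans (hvD d hd))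
        ⟨j + 1, fun k hk => ?_⟩
      exact inf_eq_zero_of_le (ha k) (le_inf (ha j) hv0) le_rfl inf_le_left
        (hdisj k j (by omega))
    have : v = 0 := key v hv0 hvD ⟨0, fun k _ => hva k⟩
    exact le_sup_left.trans this.le
  · rintro d ⟨n, hn⟩
    exact ⟨n, fun k hk => by rw [sub_zero, abs_of_nonneg (ha k)]; exact hn k hk⟩

/-- Order convergence to `0` implies norm convergence when the norm is order continuous. -/
theorem tendsto_norm_of_orderTendsto (hF : IsOrderContinuousNorm F) {A : Type v} [Preorder A]
    {x : A → F} (h : OrderTendsto x 0) : Tendsto (fun α => ‖x α‖) atTop (𝓝 0) := by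
  obtain ⟨D, hD, hx⟩ := h
  rw [Metric.tendsto_nhds]
  intro ε hε
  obtain ⟨d, hd, hdε⟩ := hF D hD ε hε
  obtain ⟨α₀, hα₀⟩ := hx d hd
  filter_upwards [eventually_ge_atTop α₀] with α hα
  have h1 := hα₀ α hα
  rw [sub_zero] at h1
  have h2 := norm_le_norm_of_nonneg_of_le (abs_nonneg _) h1
  rw [norm_abs_eq_norm] at h2
  simpa using h2.trans_lt hdε

/-! ### Extraction of a disjoint sequence. -/

/-- Disjointification: if `x i ⊓ s` tends to `0` in norm for every `s ≥ 0`, while frequently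
`x i` has norm between `ε` and `M`, then there is a sequence of terms of `x` dominating pairwise
disjoint positive elements of norm at least `ε / 2`. -/
theorem exists_disjoint_seq [NormedSpace ℝ F] [IsOrderedModule ℝ F] [CompleteSpace F]
    {ι : Type v} {l : Filter ι} {x : ι → F} (hx : ∀ i, 0 ≤ x i)
    (hun : ∀ s, 0 ≤ s → Tendsto (fun i => ‖x i ⊓ s‖) l (𝓝 0)) {ε M : ℝ} (hε : 0 < ε)
    {P : ℕ → ι → Prop} (hP : ∀ n, ∃ᶠ i in l, ε ≤ ‖x i‖ ∧ ‖x i‖ ≤ M ∧ P n i) :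
    ∃ (φ : ℕ → ι) (v : ℕ → F), (∀ n, P n (φ n)) ∧ (∀ n, 0 ≤ v n) ∧ (∀ n, v n ≤ x (φ n)) ∧
      (∀ n, ε / 2 ≤ ‖v n‖) ∧ ∀ m n, m ≠ n → v m ⊓ v n = 0 := by
  have hM : 0 < M := by
    obtain ⟨i, h1, h2, -⟩ := (hP 0).exists
    linarith
  have hsel : ∀ (n : ℕ) (s : F), ∃ i, 0 ≤ s →
      (ε ≤ ‖x i‖ ∧ ‖x i‖ ≤ M ∧ P n i) ∧ ‖x i ⊓ s‖ ≤ ε / 4 := by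
    intro n s
    by_cases hs : 0 ≤ s
    · have h1 : ∀ᶠ i in l, ‖x i ⊓ s‖ < ε / 4 :=
        (hun s hs).eventually_lt_const (by positivity)
      obtain ⟨i, hi, hi'⟩ := ((hP n).and_eventually h1).exists
      exact ⟨i, fun _ => ⟨hi, hi'.le⟩⟩
    · exact ⟨(hP 0).exists.choose, fun h => absurd h hs⟩
  choose f hf using hsel
  -- The weights `c n` sum to `δ`: the bound `δ ≤ 1` gives `c n ≤ 1`, and `δ * M ≤ ε / 4` makes `‖w‖
  -- ≤ ε / 4`.
  set δ : ℝ := min 1 (ε / (4 * M)) with hδ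
  have hδ0 : 0 < δ := lt_min one_pos (by positivity)
  have hδM : δ * M ≤ ε / 4 := by
    calc δ * M ≤ ε / (4 * M) * M := by gcongr; exact min_le_right _ _
      _ = ε / 4 := by field_simp
  let c : ℕ → ℝ := fun n => δ * ((1 / 2) ^ n / 2)
  have hc0 : ∀ n, 0 < c n := fun n => by positivity
  have hc1 : ∀ n, c n ≤ 1 := fun n => by
    have h1 : ((1 : ℝ) / 2) ^ n ≤ 1 := pow_le_one₀ (by norm_num) (by norm_num)
    have h2 : (0 : ℝ) ≤ (1 / 2) ^ n := by positivity
    have h3 : δ ≤ 1 := min_le_left _ _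
    simp only [c]
    nlinarith
  have hcsum : HasSum c δ := by
    have h1 := (hasSum_geometric_two.div_const 2).mul_left δ
    simpa [c] using h1
  -- `S n` sums the terms chosen so far; the next term is chosen almost disjoint from `(c n)⁻¹ • S
  -- n`.
  let S : ℕ → F := fun n => Nat.rec 0 (fun n s => s + x (f n ((c n)⁻¹ • s))) n
  let φ : ℕ → ι := fun n => f n ((c n)⁻¹ • S n)
  have hSsucc : ∀ n, S (n + 1) = S n + x (φ n) := fun n => rfl
  have hSmono : Monotone S := monotone_nat_of_le_succ fun n => by
    rw [hSsucc]; exact le_add_of_nonneg_right (hx _)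
  have hS0 : ∀ n, 0 ≤ S n := fun n => hSmono (Nat.zero_le n)
  have hxS : ∀ {m n}, m < n → x (φ m) ≤ S n := fun {m n} h =>
    (le_add_of_nonneg_left (hS0 m)).trans ((hSsucc m).symm.le.trans (hSmono h))
  have hT0 : ∀ n, 0 ≤ (c n)⁻¹ • S n := fun n => smul_nonneg (inv_nonneg.2 (hc0 n).le) (hS0 n)
  have hφ := fun n => hf n _ (hT0 n)
  have hbound : ∀ n, ‖c n • x (φ n)‖ ≤ c n * M := fun n => by
    rw [norm_smul, Real.norm_of_nonneg (hc0 n).le]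
    exact mul_le_mul_of_nonneg_left (hφ n).1.2.1 (hc0 n).le
  have hsumm : Summable fun n => c n • x (φ n) :=
    Summable.of_norm_bounded (hcsum.summable.mul_right M) hbound
  set w : F := ∑' n, c n • x (φ n) with hw
  have hterm : ∀ n, 0 ≤ c n • x (φ n) := fun n => smul_nonneg (hc0 n).le (hx _)
  have hw0 : 0 ≤ w := tsum_nonneg hterm
  have hxw : ∀ n, c n • x (φ n) ≤ w := fun n => hsumm.le_tsum n fun j _ => hterm j
  have hwnorm : ‖w‖ ≤ ε / 4 :=
    (tsum_of_norm_bounded (hcsum.mul_right M) hbound).trans hδM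
  -- Subtracting `(c n)⁻¹ • S n` separates `v n` from earlier terms, subtracting `w` from later
  -- ones.
  let v : ℕ → F := fun n => (x (φ n) - (c n)⁻¹ • S n - w)⁺
  have hv0 : ∀ n, 0 ≤ v n := fun n => posPart_nonneg _
  have hdisj : ∀ m n, m < n → v m ⊓ v n = 0 := by
    intro m n hmn
    set b : F := x (φ n) - (c n)⁻¹ • x (φ m) with hb
    have h1 : v n ≤ b⁺ := by
      refine posPart_mono ?_
      have h2 := smul_le_smul_of_nonneg_left (hxS hmn) (inv_nonneg.2 (hc0 n).le)
      exact (sub_le_self _ hw0).trans (sub_le_sub_left h2 _)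
    have h2 : v m ≤ b⁻ := by
      refine sup_le ?_ (negPart_nonneg _)
      calc x (φ m) - (c m)⁻¹ • S m - w ≤ x (φ m) - c n • x (φ n) :=
            sub_le_sub (sub_le_self _ (hT0 m)) (hxw n)
        _ = c n • (-b) := by
            rw [hb, neg_sub, smul_sub, smul_inv_smul₀ (hc0 n).ne']
        _ ≤ c n • b⁻ := smul_le_smul_of_nonneg_left (neg_le_negPart b) (hc0 n).le
        _ ≤ (1 : ℝ) • b⁻ := smul_le_smul_of_nonneg_right (hc1 n) (negPart_nonneg _)
        _ = b⁻ := one_smul _ _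
    exact inf_eq_zero_of_le (hv0 m) (hv0 n) h2 h1
      (by rw [inf_comm]; exact posPart_inf_negPart_eq_zero b)
  refine ⟨φ, v, fun n => (hφ n).1.2.2, hv0, fun n => ?_, fun n => ?_, fun m n hmn => ?_⟩
  · exact sup_le ((sub_le_self _ hw0).trans (sub_le_self _ (hT0 n))) (hx _)
  -- The two corrections cost at most `ε / 4` each.
  · have h1 : x (φ n) ≤ v n + x (φ n) ⊓ ((c n)⁻¹ • S n) + w := by
      have h2 : x (φ n) - w - v n ≤ x (φ n) ⊓ ((c n)⁻¹ • S n) := by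
        refine le_inf ((sub_le_self _ (hv0 n)).trans (sub_le_self _ hw0)) ?_
        rw [sub_le_iff_le_add, ← sub_le_iff_le_add', sub_right_comm]
        exact le_posPart _
      rw [sub_le_iff_le_add, sub_le_iff_le_add] at h2
      rwa [add_comm (v n)]
    have h2 := norm_le_norm_of_nonneg_of_le (hx _) h1
    have h3 := norm_add₃_le (a := v n) (b := x (φ n) ⊓ ((c n)⁻¹ • S n)) (c := w)
    have h4 := (hφ n).2
    have h5 := (hφ n).1.1
    change ‖x (φ n) ⊓ ((c n)⁻¹ • S n)‖ ≤ ε / 4 at h4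
    change ε ≤ ‖x (φ n)‖ at h5
    linarith
  · rcases lt_or_gt_of_ne hmn with h | h
    · exact hdisj m n h
    · rw [inf_comm]; exact hdisj n m h

/-! ### The three implications. -/

variable [NormedSpace ℝ F] [IsOrderedModule ℝ F] [CompleteSpace F]

/-- In a vector lattice `p + q - 2 • (p ⊓ q) = |p - q|`, and `||z| - |y|| ≤ |z + y|` by the triangle
inequality. -/
theorem modulus_add_modulus_le (z y : Complexification F) :
    z.modulus + y.modulus ≤ (z + y).modulus + (2 : ℝ) • (y.modulus ⊓ z.modulus) := by
  have hneg : ∀ a : Complexification F, (-a).modulus = a.modulus := fun a => by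
    simpa using modulus_smul (-1 : ℂ) a
  have h1 : z.modulus ≤ (z + y).modulus + y.modulus := by
    simpa [hneg] using modulus_add_le (z + y) (-y)
  have h2 : y.modulus ≤ (z + y).modulus + z.modulus := by
    simpa [hneg] using modulus_add_le (z + y) (-z)
  rw [two_smul, ← sub_le_iff_le_add', inf_add, add_inf, add_inf]
  refine le_inf (le_inf ?_ ?_) (le_inf ?_ ?_) <;> rw [sub_le_iff_le_add']
  · rw [← add_assoc]; gcongr
  · rw [add_comm z.modulus]; exact le_add_of_nonneg_left (modulus_nonneg _)
  · exact le_add_of_nonneg_left (modulus_nonneg _)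
  · rw [← add_assoc, add_comm z.modulus]; gcongr

theorem IsBLSpace.isSigmaBLSpace (h : IsBLSpace.{u, v} F) : IsSigmaBLSpace F := by
  intro z w hz hzw
  -- Index sets live in universe `v`, hence the lifted copy of `ℕ`.
  let e : ULift.{v} ℕ ≃o ℕ := ⟨Equiv.ulift, Iff.rfl⟩
  have hdown : Tendsto (ULift.down : ULift.{v} ℕ → ℕ) atTop atTop := e.tendsto_atTop
  have hup : Tendsto (ULift.up : ℕ → ULift.{v} ℕ) atTop atTop := e.symm.tendsto_atTop
  have : IsDirectedOrder (ULift.{v} ℕ) :=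
    ⟨fun a b => ⟨⟨max a.down b.down⟩, le_max_left a.down b.down, le_max_right a.down b.down⟩⟩
  refine (h (ULift.{v} ℕ) (fun n => z n.down) w (hz.comp hdown) ?_).comp hup
  intro s hs
  obtain ⟨D, hD, hx⟩ := hzw s hs
  refine ⟨D, hD, fun d hd => ?_⟩
  obtain ⟨n, hn⟩ := hx d hd
  exact ⟨⟨n⟩, fun k hk => hn k.down hk⟩

theorem IsSigmaBLSpace.hasBLProperty (h : IsSigmaBLSpace F) : HasBLProperty F := by
  intro a a₀ ha hnorm hdisj ha₀
  by_contra! hlim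
  have hle : ∀ n, ‖a₀‖ ≤ ‖a₀ + a n‖ := fun n =>
    norm_le_norm_of_nonneg_of_le ha₀ (le_add_of_nonneg_right (ha n))
  -- A real `limsup` controls the sequence only once boundedness is known.
  have hbdd : IsBoundedUnder (· ≤ ·) atTop fun n => ‖a₀ + a n‖ :=
    isBoundedUnder_of ⟨‖a₀‖ + 1, fun n => (norm_add_le _ _).trans (by rw [hnorm])⟩
  have htend : Tendsto (fun n => ‖a₀ + a n‖) atTop (𝓝 ‖a₀‖) := by
    refine tendsto_order.2 ⟨fun b hb => .of_forall fun n => hb.trans_le (hle n), fun b hb => ?_⟩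
    exact eventually_lt_of_limsup_lt (hlim.trans_lt hb) hbdd
  have hsub : ∀ n, ofReal (a₀ + a n) - ofReal a₀ = ofReal (a n) := fun n => by ext <;> simp
  have h1 := h (fun n => ofReal (a₀ + a n)) (ofReal a₀) (by simpa only [norm_ofReal] using htend) ?_
  · simp only [hsub, norm_ofReal, hnorm] at h1
    exact one_ne_zero (tendsto_nhds_unique tendsto_const_nhds h1)
  · intro s hs
    simp only [hsub, modulus_ofReal, abs_of_nonneg (ha _)]
    exact orderTendsto_zero_of_disjoint (fun n => le_inf (ha n) hs) (fun n => inf_le_right)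
      fun m n hmn => inf_eq_zero_of_le (le_inf (ha m) hs) (le_inf (ha n) hs) inf_le_left
        inf_le_left (hdisj m n hmn)

theorem HasBLProperty.isBLSpace (hF : IsOrderContinuousNorm F) (h : HasBLProperty F) :
    IsBLSpace.{u, v} F := by
  intro A _ _ _ z w hz hzw
  by_contra hnot
  have hun : ∀ s : F, 0 ≤ s → Tendsto (fun α => ‖(z α - w).modulus ⊓ s‖) atTop (𝓝 0) :=
    fun s hs => tendsto_norm_of_orderTendsto hF (hzw s hs)
  obtain ⟨ε, hε, hfreq⟩ : ∃ ε > 0, ∃ᶠ α in atTop, ε ≤ ‖z α - w‖ := by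
    rw [Metric.tendsto_nhds] at hnot
    push Not at hnot
    simpa using hnot
  have hsum : ∀ α, ‖w.modulus + (z α - w).modulus‖ ≤
      ‖z α‖ + 2 * ‖(z α - w).modulus ⊓ w.modulus‖ := by
    intro α
    have h1 := modulus_add_modulus_le w (z α - w)
    rw [add_sub_cancel] at h1
    refine (norm_le_norm_of_nonneg_of_le
      (add_nonneg (modulus_nonneg _) (modulus_nonneg _)) h1).trans ((norm_add_le _ _).trans ?_)
    rw [norm_smul, Real.norm_ofNat, norm_def]
  have hlim : Tendsto (fun α => ‖z α‖ + 2 * ‖(z α - w).modulus ⊓ w.modulus‖) atTop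
      (𝓝 ‖w‖) := by
    simpa using hz.add ((hun _ (modulus_nonneg w)).const_mul 2)
  have hev : ∀ r, ‖w‖ < r → ∀ᶠ α in atTop, ‖w.modulus + (z α - w).modulus‖ < r := fun r hr =>
    (hlim.eventually_lt_const hr).mono fun α hα => (hsum α).trans_lt hα
  -- `φ` need not be cofinal in `A`: the predicate `P n` alone carries the asymptotic bound `‖w‖`
  -- along the sequence.
  obtain ⟨φ, v, hφ, hv0, hvle, hvnorm, hdisj⟩ := exists_disjoint_seq
    (x := fun α => (z α - w).modulus) (l := atTop) (M := ‖w‖ + 1)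
    (P := fun n α => ‖w.modulus + (z α - w).modulus‖ < ‖w‖ + 1 / ((n : ℝ) + 1))
    (fun α => modulus_nonneg _) hun hε (fun n => by
      refine (hfreq.and_eventually ((hev (‖w‖ + 1) (by linarith)).and
        (hev (‖w‖ + 1 / ((n : ℝ) + 1)) (by simp; positivity)))).mono ?_
      rintro α ⟨h1, h2, h3⟩
      exact ⟨h1, (norm_le_norm_of_nonneg_of_le (modulus_nonneg _)
        (le_add_of_nonneg_left (modulus_nonneg _))).trans h2.le, h3⟩)
  -- The norms `‖v n‖` vary but `u₀` must be fixed, so their common lower bound `c` sets the scale: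
  -- `a n ≤ c⁻¹ • v n`, tested against `u₀ = c⁻¹ • |w|`.
  set c : ℝ := ε / 2 with hc
  have hc0 : 0 < c := by positivity
  have hvpos : ∀ n, 0 < ‖v n‖ := fun n => hc0.trans_le (hvnorm n)
  let a : ℕ → F := fun n => ‖v n‖⁻¹ • v n
  have ha0 : ∀ n, 0 ≤ a n := fun n => smul_nonneg (inv_nonneg.2 (hvpos n).le) (hv0 n)
  have hale : ∀ n, a n ≤ c⁻¹ • v n := fun n =>
    smul_le_smul_of_nonneg_right (inv_anti₀ hc0 (hvnorm n)) (hv0 n)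
  have hadisj : ∀ m n, m ≠ n → a m ⊓ a n = 0 := by
    intro m n hmn
    refine inf_eq_zero_of_le (ha0 m) (ha0 n) (hale m) (hale n) ?_
    have hci : 0 ≤ c⁻¹ := inv_nonneg.2 hc0.le
    refine le_antisymm ?_ (le_inf (smul_nonneg hci (hv0 m)) (smul_nonneg hci (hv0 n)))
    have h1 : c • ((c⁻¹ • v m) ⊓ (c⁻¹ • v n)) ≤ v m ⊓ v n := by
      refine le_inf ?_ ?_
      · exact (smul_le_smul_of_nonneg_left inf_le_left hc0.le).trans_eq
          (smul_inv_smul₀ hc0.ne' _)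
      · exact (smul_le_smul_of_nonneg_left inf_le_right hc0.le).trans_eq
          (smul_inv_smul₀ hc0.ne' _)
    rw [hdisj m n hmn] at h1
    have h2 := smul_le_smul_of_nonneg_left h1 hci
    rwa [inv_smul_smul₀ hc0.ne', smul_zero] at h2
  have hBL := h a (c⁻¹ • w.modulus) ha0 (fun n => by
    rw [norm_smul, norm_inv, norm_norm, inv_mul_cancel₀ (hvpos n).ne']) hadisj
    (smul_nonneg (inv_nonneg.2 hc0.le) (modulus_nonneg w))
  have hupper : ∀ n : ℕ, ‖c⁻¹ • w.modulus + a n‖ ≤ c⁻¹ * (‖w‖ + 1 / ((n : ℝ) + 1)) := by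
    intro n
    have h1 : c⁻¹ • w.modulus + a n ≤ c⁻¹ • (w.modulus + (z (φ n) - w).modulus) := by
      rw [smul_add]
      exact add_le_add_right ((hale n).trans
        (smul_le_smul_of_nonneg_left (hvle n) (inv_nonneg.2 hc0.le))) _
    refine (norm_le_norm_of_nonneg_of_le (add_nonneg
      (smul_nonneg (inv_nonneg.2 hc0.le) (modulus_nonneg w)) (ha0 n)) h1).trans ?_
    rw [norm_smul, norm_inv, Real.norm_of_nonneg hc0.le]
    exact mul_le_mul_of_nonneg_left (hφ n).le (inv_nonneg.2 hc0.le)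
  have htend : Tendsto (fun n : ℕ => c⁻¹ * (‖w‖ + 1 / ((n : ℝ) + 1))) atTop
      (𝓝 (c⁻¹ * ‖w‖)) := by
    simpa using (tendsto_one_div_add_atTop_nhds_zero_nat.const_add ‖w‖).const_mul c⁻¹
  have hsup : limsup (fun n => ‖c⁻¹ • w.modulus + a n‖) atTop ≤ c⁻¹ * ‖w‖ := by
    rw [← htend.limsup_eq]
    exact limsup_le_limsup (.of_forall hupper)
      (isCoboundedUnder_le_of_le atTop (x := 0) fun n => norm_nonneg _)
      htend.isBoundedUnder_le
  rw [norm_smul, norm_inv, Real.norm_of_nonneg hc0.le] at hBL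
  exact (hBL.trans_le hsup).false

end BrezisLieb

theorem corollary2p7 {F : Type u} [NormedAddCommGroup F] [Lattice F] [HasSolidNorm F]
    [IsOrderedAddMonoid F] [NormedSpace ℝ F] [IsOrderedModule ℝ F] [CompleteSpace F]
    (hF : IsOrderContinuousNorm F) :
    List.TFAE [IsBLSpace.{u, v} F, IsSigmaBLSpace F, HasBLProperty F] := by
  tfae_have 1 → 2 := BrezisLieb.IsBLSpace.isSigmaBLSpace
  tfae_have 2 → 3 := BrezisLieb.IsSigmaBLSpace.hasBLProperty
  tfae_have 3 → 1 := BrezisLieb.HasBLProperty.isBLSpace hF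
  tfae_finish
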